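/- Let $F$ be an algebraically closed field of characteristic zero with infinite transcendence degree over $\mathbb{Q}$, and let $n\ge 1$ be an integer. Let ${\rm SO}_n(F)$ be the group of $n\times n$ matrices $A$ over $F$ with $AA^T={\rm I}_n$ and $\det A=1$. Every field automorphism $\varphi$ of $F$ induces an automorphism $\varphi_n$ of ${\rm SO}_n(F)$, $\varphi_n((a_{i,j}))=(\varphi(a_{i,j}))$. For an automorphism $\psi$ of a group $G$, elements $x,y\in G$ are called $\psi$-conjugate if $x=zy\psi(z)^{-1}$ for some $z\in G$; this is an equivalence relation, and the Reidemeister number $R(\psi)$ is the number of its classes (a positive integer or $\infty$). Then there exists an automorphism $\varphi$ of $F$ (possibly depending on $n$) such that the induced automorphism $\varphi_n$ of ${\rm SO}_n(F)$ satisfies $R(\varphi_n)=1$; that is, every matrix in ${\rm SO}_n(F)$ is $\varphi_n$-conjugate to ${\rm I}_n$ within ${\rm SO}_n(F)$. -/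

import Mathlib

/-- The relation of `φ`-conjugacy on a group `G`, for an automorphism `φ` of `G`:
`x` and `y` are `φ`-conjugate if `x = z * y * φ(z)⁻¹` for some `z` in `G`. -/
def TwistedConj {G : Type*} [Group G] (φ : G ≃* G) (x y : G) : Prop :=
  ∃ z : G, x = z * y * (φ z)⁻¹

/-- `φ`-conjugacy is an equivalence relation. -/
theorem twistedConj_equivalence {G : Type*} [Group G] (φ : G ≃* G) :
    Equivalence (TwistedConj φ) where
  refl x := ⟨1, by simp⟩
  symm := by
    rintro x y ⟨z, rfl⟩
    exact ⟨z⁻¹, by simp [mul_assoc]⟩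
  trans := by
    rintro x y w ⟨z, rfl⟩ ⟨t, rfl⟩
    exact ⟨z * t, by simp [mul_assoc]⟩

/-- `φ`-conjugacy as a setoid; its classes are the `φ`-conjugacy classes. -/
def twistedConjSetoid {G : Type*} [Group G] (φ : G ≃* G) : Setoid G :=
  ⟨TwistedConj φ, twistedConj_equivalence φ⟩

/-- The Reidemeister number `R(φ)`: the number of `φ`-conjugacy classes, a positive integer or `∞`
(infinite cardinals are not distinguished). -/
noncomputable def reidemeisterNumber {G : Type*} [Group G] (φ : G ≃* G) : ℕ∞ :=
  ENat.card (Quotient (twistedConjSetoid φ))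

/-- Applying a ring homomorphism to each entry preserves the special orthogonal group. -/
theorem map_mem_specialOrthogonalGroup {F : Type*} [Field F] {n : ℕ} (φ : F →+* F)
    {A : Matrix (Fin n) (Fin n) F} (hA : A ∈ Matrix.specialOrthogonalGroup (Fin n) F) :
    A.map φ ∈ Matrix.specialOrthogonalGroup (Fin n) F := by
  rw [Matrix.mem_specialOrthogonalGroup_iff, Matrix.mem_orthogonalGroup_iff] at hA ⊢
  refine ⟨?_, ?_⟩
  · rw [← Matrix.transpose_map, ← Matrix.map_mul, hA.1, Matrix.map_one _ φ.map_zero φ.map_one]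
  · rw [← RingHom.mapMatrix_apply, ← RingHom.map_det, hA.2, map_one]

/-- The automorphism `φ_n` of `SO_n(F)` induced by a field automorphism `φ` of `F`:
it applies `φ` to each entry of a matrix. -/
def inducedSO {F : Type*} [Field F] (n : ℕ) (φ : F ≃+* F) :
    Matrix.specialOrthogonalGroup (Fin n) F ≃* Matrix.specialOrthogonalGroup (Fin n) F where
  toFun A := ⟨A.1.map φ, map_mem_specialOrthogonalGroup (φ : F →+* F) A.2⟩
  invFun A := ⟨A.1.map φ.symm, map_mem_specialOrthogonalGroup (φ.symm : F →+* F) A.2⟩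
  left_inv A := by ext i j; simp
  right_inv A := by ext i j; simp
  map_mul' A B := by
    apply Subtype.ext
    exact Matrix.map_mul (f := (φ : F →+* F))

-- Two ideas carry the proof. The first produces a `φ` whose Lang map on `GL_n` is onto
-- (`exists_ringEquiv_lang`). Adjoin to `F` a generic matrix `X_A` for each invertible `A`, and
-- extend an automorphism `σ` by `X_A ↦ A⁻¹ X_A`; then `X_A` solves `A * τ(Z) = Z`. The algebraic
-- closure of the enlarged field has the cardinality of `F`, so by Steinitz it is again `F`.
-- Starting from the identity and iterating countably often, the direct limit solves its own
-- equations, and it is once more isomorphic to `F`. A square root of `-1` from the initial stage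
-- stays fixed.
--
-- The second passes from `GL_n` to `SO_n` (`twistedConj_inducedSO_one`). If `A` is orthogonal and
-- `A * φ(Z) = Z`, the Gram matrix `Zᵀ Z` is fixed by `φ`. Diagonalizing it over the fixed field and
-- rescaling by square roots, which `φ` multiplies by signs, gives an orthogonal `Y` with `A * φ(Y)
-- = Y * ε`, where `ε` is a diagonal sign matrix. As `det A = 1`, the signs `-1` come in pairs, and
-- each pair is removed by a plane rotation that `φ` negates on its plane.

universe u

/-! ### Steinitz: recognizing `F` by cardinality -/

open Cardinal in
theorem IsAlgClosed.cardinalMk_eq_trdeg_rat {F : Type*} [Field F] [IsAlgClosed F] [CharZero F]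
    (htr : Cardinal.aleph0 ≤ Algebra.trdeg ℚ F) : #F = Algebra.trdeg ℚ F := by
  obtain ⟨s, hs⟩ := exists_isTranscendenceBasis ℚ F
  have h1 := IsAlgClosed.cardinal_le_max_transcendence_basis _ hs
  have h2 : #s = Algebra.trdeg ℚ F := hs.cardinalMk_eq_trdeg
  simp only [lift_id, Cardinal.mkRat, h2, lift_aleph0] at h1
  refine le_antisymm (h1.trans (by simp [htr])) ?_
  rw [← h2]
  exact mk_subtype_le _

/-- An algebraically closed extension, of the same cardinality, of an algebraically closed field
of characteristic zero with infinite transcendence degree is isomorphic to that field. -/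
theorem IsAlgClosed.nonempty_ringEquiv_of_cardinalMk_le {F K : Type u} [Field F] [IsAlgClosed F]
    [CharZero F] (htr : Cardinal.aleph0 ≤ Algebra.trdeg ℚ F) [Field K] [IsAlgClosed K]
    (f : F →+* K) (hK : Cardinal.mk K ≤ Cardinal.mk F) :
    Nonempty (F ≃+* K) := by
  have : CharZero K := charZero_of_injective_ringHom f.injective
  obtain ⟨s, hs⟩ := exists_isTranscendenceBasis ℚ F
  obtain ⟨t, ht⟩ := exists_isTranscendenceBasis ℚ K
  have h1 := hs.cardinalMk_eq_trdeg
  have h2 := ht.cardinalMk_eq_trdeg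
  have h3 := trdeg_le_of_injective f.toRatAlgHom f.injective
  -- The chain is `trdeg F ≤ trdeg K ≤ #K ≤ #F = trdeg F`.
  have h5 : Cardinal.mk s = Cardinal.mk t := by
    refine le_antisymm (by rw [h1, h2]; exact h3) ?_
    rw [h1, ← IsAlgClosed.cardinalMk_eq_trdeg_rat htr]
    exact (Cardinal.mk_subtype_le _).trans hK
  obtain ⟨e⟩ := Cardinal.eq.1 h5
  exact ⟨IsAlgClosed.equivOfTranscendenceBasis _ _ e hs ht⟩

/-! ### Generic solutions of the twisted equations -/

section GenericMatrices

variable (F : Type*) [Field F] (n : ℕ)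

/-- Polynomials in the entries of independent generic `n × n` matrices, one for each invertible
matrix over `F`. -/
abbrev GenericMatrixRing : Type _ :=
  MvPolynomial (GL (Fin n) F × Fin n × Fin n) F

variable {F n}

/-- The ring endomorphism that acts on the coefficients by `σ` and sends the generic matrix
`X_A` to `B_A * X_A`. -/
noncomputable def GenericMatrixRing.twist (σ : F →+* F)
    (B : GL (Fin n) F → Matrix (Fin n) (Fin n) F) :
    GenericMatrixRing F n →+* GenericMatrixRing F n :=
  MvPolynomial.eval₂Hom (MvPolynomial.C.comp σ)
    fun p => ∑ k, MvPolynomial.C (B p.1 p.2.1 k) * MvPolynomial.X (p.1, k, p.2.2)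

/-- The composite sends `X_A` to `σ(C_A) * B_A * X_A`; used in both orders, this makes the twist
invertible. -/
theorem GenericMatrixRing.twist_comp_twist (σ τ : F →+* F)
    (B C : GL (Fin n) F → Matrix (Fin n) (Fin n) F)
    (h : ∀ x, σ (τ x) = x) (hBC : ∀ A, (C A).map σ * B A = 1) :
    (twist σ B).comp (twist τ C) = RingHom.id _ := by
  apply MvPolynomial.ringHom_ext
  · intro r; simp [twist, h]
  · rintro ⟨A, i, j⟩
    have : ∀ l, ∑ k, σ (C A i k) * B A k l = if i = l then 1 else 0 := by
      intro l
      have := congrFun (congrFun (hBC A) i) l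
      simpa [Matrix.mul_apply, Matrix.one_apply] using this
    simp only [twist, RingHom.comp_apply, MvPolynomial.eval₂Hom_X', map_sum, map_mul,
      MvPolynomial.eval₂Hom_C, Finset.mul_sum, RingHom.id_apply]
    rw [Finset.sum_comm]
    simp_rw [← mul_assoc, ← map_mul, ← Finset.sum_mul, ← map_sum, this]
    simp

/-- The twisting automorphism that acts on the coefficients by `σ` and sends the generic matrix
`X_A` to `A⁻¹ * X_A`. -/
noncomputable def GenericMatrixRing.twistEquiv (σ : F ≃+* F) :
    GenericMatrixRing F n ≃+* GenericMatrixRing F n :=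
  RingEquiv.ofRingHom (twist (σ : F →+* F) fun A => ((A⁻¹ : GL (Fin n) F) : Matrix _ _ F))
    (twist (σ.symm : F →+* F) fun A => (A : Matrix (Fin n) (Fin n) F).map σ.symm)
    (twist_comp_twist _ _ _ _ (by simp) fun A => by
      have : ((A : Matrix (Fin n) (Fin n) F).map σ.symm).map (σ : F →+* F) = A := by
        ext; simp
      rw [this, ← Units.val_mul, mul_inv_cancel, Units.val_one])
    (twist_comp_twist _ _ _ _ (by simp) fun A => by
      have h := congrArg (fun M : Matrix (Fin n) (Fin n) F => M.map (σ.symm : F →+* F))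
        (A.inv_mul)
      simp only [Matrix.map_mul] at h
      exact h.trans (Matrix.map_one _ (map_zero _) (map_one _)))

theorem GenericMatrixRing.twistEquiv_C (σ : F ≃+* F) (x : F) :
    (twistEquiv σ : GenericMatrixRing F n ≃+* _) (MvPolynomial.C x) = MvPolynomial.C (σ x) :=
  MvPolynomial.eval₂Hom_C _ _ x

theorem GenericMatrixRing.twistEquiv_X (σ : F ≃+* F) (A : GL (Fin n) F) (i j : Fin n) :
    twistEquiv σ (MvPolynomial.X (A, i, j)) = ∑ k,
      MvPolynomial.C (((A⁻¹ : GL (Fin n) F) : Matrix _ _ F) i k) * MvPolynomial.X (A, k, j) :=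
  MvPolynomial.eval₂Hom_X' _ _ _

theorem GenericMatrixRing.det_ne_zero (A : GL (Fin n) F) :
    (Matrix.of fun i j => (MvPolynomial.X (A, i, j) : GenericMatrixRing F n)).det ≠ 0 := by
  intro h
  -- Specialize every generic matrix to the identity, where the determinant is `1`.
  have := congrArg (MvPolynomial.eval fun p => (1 : Matrix (Fin n) (Fin n) F) p.2.1 p.2.2) h
  rw [RingHom.map_det, map_zero] at this
  have h1 : (MvPolynomial.eval fun p : GL (Fin n) F × Fin n × Fin n =>
      (1 : Matrix (Fin n) (Fin n) F) p.2.1 p.2.2).mapMatrix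
      (Matrix.of fun i j => (MvPolynomial.X (A, i, j))) = 1 := by
    ext i j; simp
  rw [h1] at this
  simp at this

/-- Adjoining generic matrices to an algebraically closed field of infinite transcendence degree
yields an isomorphic field, over which twisted equations with coefficients in the original field
are solvable. -/
theorem exists_ringHom_forall_extend_solving [IsAlgClosed F] [CharZero F]
    (htr : Cardinal.aleph0 ≤ Algebra.trdeg ℚ F) (n : ℕ) :
    ∃ ι : F →+* F, ∀ σ : F ≃+* F, ∃ τ : F ≃+* F, (∀ x, τ (ι x) = ι (σ x)) ∧
      ∀ A : Matrix (Fin n) (Fin n) F, A.det ≠ 0 →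
        ∃ Z : Matrix (Fin n) (Fin n) F, Z.det ≠ 0 ∧ A.map ι * Z.map τ = Z := by
  let R := GenericMatrixRing F n
  let Q := FractionRing R
  let K := AlgebraicClosure Q
  let f : R →+* K := (algebraMap Q K).comp (algebraMap R Q)
  have hf : Function.Injective f :=
    (algebraMap Q K).injective.comp (IsFractionRing.injective R Q)
  have hinf : Cardinal.aleph0 ≤ Cardinal.mk F := by
    rw [IsAlgClosed.cardinalMk_eq_trdeg_rat htr]; exact htr
  have hcard : Cardinal.mk K ≤ Cardinal.mk F := by
    refine (Algebra.IsAlgebraic.cardinalMk_le_max Q K).trans (max_le ?_ hinf)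
    rw [Cardinal.mk_fractionRing]
    refine MvPolynomial.cardinalMk_le_max.trans (max_le (max_le le_rfl ?_) hinf)
    have h1 : Cardinal.mk (GL (Fin n) F) ≤ Cardinal.mk F := by
      have h2 : Cardinal.mk (Fin n × Fin n → F) ≤ Cardinal.mk F := by
        have := Cardinal.power_nat_le_max (c := Cardinal.mk F) (n := n * n)
        rw [max_eq_left hinf] at this
        simpa using this
      refine le_trans (Cardinal.mk_le_of_injective
        (f := fun A : GL (Fin n) F => fun p : Fin n × Fin n => A p.1 p.2) ?_) h2
      intro A B h
      ext i j
      exact congrFun h (i, j)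
    rw [Cardinal.mk_prod]
    refine Cardinal.mul_le_of_le hinf (by simpa using h1) ?_
    simpa using (Cardinal.natCast_lt_aleph0 (n := n * n)).le.trans hinf
  obtain ⟨e⟩ := IsAlgClosed.nonempty_ringEquiv_of_cardinalMk_le htr
    (f.comp MvPolynomial.C) hcard
  refine ⟨(e.symm : K →+* F).comp (f.comp MvPolynomial.C), fun σ => ?_⟩
  let θ : Q ≃+* Q := IsFractionRing.ringEquivOfRingEquiv
    (GenericMatrixRing.twistEquiv σ : R ≃+* R)
  let ψ : K ≃+* K := IsAlgClosure.equivOfEquiv K K θ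
  have hψ : ∀ r : R, ψ (f r) = f (GenericMatrixRing.twistEquiv σ r) := by
    intro r
    simp only [ψ, f, RingHom.comp_apply, IsAlgClosure.equivOfEquiv_algebraMap]
    exact congrArg _ (IsFractionRing.ringEquivOfRingEquiv_algebraMap _ r)
  refine ⟨(e.trans ψ).trans e.symm, fun x => ?_, fun A hA => ?_⟩
  · simp only [RingHom.comp_apply, RingEquiv.trans_apply, RingEquiv.coe_toRingHom,
      RingEquiv.apply_symm_apply, hψ]
    exact congrArg (fun r => e.symm (f r)) (GenericMatrixRing.twistEquiv_C σ x)
  · let A' : GL (Fin n) F := Matrix.GeneralLinearGroup.mkOfDetNeZero A hA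
    let X : Matrix (Fin n) (Fin n) R := Matrix.of fun i j => MvPolynomial.X (A', i, j)
    refine ⟨X.map ((e.symm : K →+* F).comp f), ?_, ?_⟩
    · have := RingHom.map_det ((e.symm : K →+* F).comp f) X
      rw [RingHom.mapMatrix_apply] at this
      rw [← this]
      refine (map_ne_zero_iff _ ?_).2 (GenericMatrixRing.det_ne_zero A')
      exact e.symm.injective.comp hf
    · have h1 : X.map (GenericMatrixRing.twistEquiv σ) =
          (((A'⁻¹ : GL (Fin n) F) : Matrix _ _ F).map MvPolynomial.C) * X := by
        ext1 i j
        simp [X, GenericMatrixRing.twistEquiv_X, Matrix.mul_apply]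
      have h2 : (X.map ((e.symm : K →+* F).comp f)).map ((e.trans ψ).trans e.symm) =
          (X.map (GenericMatrixRing.twistEquiv σ)).map ((e.symm : K →+* F).comp f) := by
        ext1 i j
        simp [hψ]
      have h3 : A.map ((e.symm : K →+* F).comp (f.comp MvPolynomial.C)) =
          (A.map (MvPolynomial.C : F →+* R)).map ((e.symm : K →+* F).comp f) := by
        ext1 i j
        simp
      rw [h2, h3, h1, ← Matrix.map_mul, ← mul_assoc, ← Matrix.map_mul]
      have h4 : A * ((A'⁻¹ : GL (Fin n) F) : Matrix _ _ F) = 1 := A'.mul_inv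
      rw [h4, Matrix.map_one _ (map_zero _) (map_one _), one_mul]

end GenericMatrices

/-! ### Direct limit along an endomorphism of `F` -/

section IterateLimit

variable {F : Type u} [Field F] (ι : F →+* F)

/-- The transition maps of the sequence `F → F → F → ⋯` with all steps equal to `ι`. -/
def iterateTransition (i j : ℕ) (_ : i ≤ j) : F →+* F := (ι : F →+* F) ^ (j - i)

instance : DirectedSystem (fun _ : ℕ => F) (iterateTransition ι · · ·) where
  map_self i x := by simp [iterateTransition]
  map_map k j i hij hjk x := by
    have : k - i = (k - j) + (j - i) := by omega
    simp [iterateTransition, this, pow_add]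

/-- The direct limit of the sequence `F → F → F → ⋯` with all steps equal to `ι`. -/
abbrev IterateLimit : Type u := DirectLimit (fun _ : ℕ => F) (iterateTransition ι)

namespace IterateLimit

/-- The inclusion of the `m`-th term. -/
noncomputable def of (m : ℕ) : F →+* IterateLimit ι :=
  DirectLimit.Ring.of (fun _ : ℕ => F) (iterateTransition ι) m

theorem of_succ (m : ℕ) (x : F) : of ι (m + 1) (ι x) = of ι m x := by
  have := DirectLimit.Ring.of_f (G := fun _ : ℕ => F) (f := iterateTransition ι) (Nat.le_succ m) x
  have h : iterateTransition ι m (m + 1) (Nat.le_succ m) x = ι x := by simp [iterateTransition]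
  rw [h] at this
  exact this

theorem exists_of_eq (x : IterateLimit ι) : ∃ m y, of ι m y = x := by
  obtain ⟨m, y, h⟩ := DirectLimit.exists_eq_mk _ x
  exact ⟨m, y, h.symm⟩

theorem range_of_mono : Monotone fun m => Set.range (of ι m) := by
  refine monotone_nat_of_le_succ fun m => ?_
  rintro _ ⟨x, rfl⟩
  exact ⟨ι x, of_succ ι m x⟩

theorem exists_forall_of_eq {α : Type*} [Finite α] (x : α → IterateLimit ι) :
    ∃ m, ∃ y : α → F, ∀ a, of ι m (y a) = x a := by
  choose k y hy using fun a => exists_of_eq ι (x a)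
  obtain ⟨m, hm⟩ := (Set.finite_range k).bddAbove
  have h : ∀ a, ∃ z, of ι m z = x a := fun a =>
    range_of_mono ι (hm ⟨a, rfl⟩) ⟨y a, hy a⟩
  choose z hz using h
  exact ⟨m, z, hz⟩

/-- The finitely many coefficients of a polynomial lie in one stage, a copy of `F`, which already
contains a root. -/
instance [IsAlgClosed F] : IsAlgClosed (IterateLimit ι) := by
  refine IsAlgClosed.of_exists_root _ fun p _ hp => ?_
  obtain ⟨m, y, hy⟩ := exists_forall_of_eq ι fun i : Fin (p.natDegree + 1) => p.coeff i
  have hlift : p ∈ Polynomial.lifts (of ι m) := by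
    rw [Polynomial.lifts_iff_coeff_lifts]
    intro i
    by_cases hi : i < p.natDegree + 1
    · exact ⟨y ⟨i, hi⟩, hy ⟨i, hi⟩⟩
    · exact ⟨0, by rw [map_zero, Polynomial.coeff_eq_zero_of_natDegree_lt (by omega)]⟩
  obtain ⟨q, rfl⟩ := (Polynomial.mem_lifts _).1 hlift
  have hq : q.degree ≠ 0 := by
    rw [← Polynomial.degree_map q (of ι m)]
    exact hp.degree_pos.ne'
  obtain ⟨x, hx⟩ := IsAlgClosed.exists_root q hq
  exact ⟨of ι m x, by rw [Polynomial.eval_map_apply, hx, map_zero]⟩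

variable {ι}

/-- The endomorphism induced by a compatible sequence of endomorphisms. -/
noncomputable def map (σ : ℕ → F →+* F) (h : ∀ m x, σ (m + 1) (ι x) = ι (σ m x)) :
    IterateLimit ι →+* IterateLimit ι :=
  DirectLimit.Ring.lift _ _ _ (fun m => (of ι m).comp (σ m)) (by
    intro i j hij x
    induction j, hij using Nat.le_induction with
    | base => simp [iterateTransition]
    | succ j hij ih =>
      have : iterateTransition ι i (j + 1) (by omega) x = ι (iterateTransition ι i j hij x) := by
        rw [iterateTransition, iterateTransition, Nat.sub_add_comm hij, pow_succ']
        rfl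
      rw [this, RingHom.comp_apply, h, of_succ]
      exact ih)

theorem map_of (σ : ℕ → F →+* F) (h : ∀ m x, σ (m + 1) (ι x) = ι (σ m x)) (m : ℕ) (x : F) :
    map σ h (of ι m x) = of ι m (σ m x) := rfl

/-- The automorphism induced by a compatible sequence of automorphisms. -/
noncomputable def mapEquiv (σ : ℕ → F ≃+* F) (h : ∀ m x, σ (m + 1) (ι x) = ι (σ m x)) :
    IterateLimit ι ≃+* IterateLimit ι :=
  RingEquiv.ofRingHom (map (fun m => (σ m : F →+* F)) h)
    (map (fun m => ((σ m).symm : F →+* F)) fun m x => by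
      simp [RingEquiv.symm_apply_eq, h])
    (by
      refine RingHom.ext fun x => ?_
      obtain ⟨m, y, rfl⟩ := exists_of_eq ι x
      exact congrArg (of ι m) ((σ m).apply_symm_apply y))
    (by
      refine RingHom.ext fun x => ?_
      obtain ⟨m, y, rfl⟩ := exists_of_eq ι x
      exact congrArg (of ι m) ((σ m).symm_apply_apply y))

theorem mapEquiv_of (σ : ℕ → F ≃+* F) (h : ∀ m x, σ (m + 1) (ι x) = ι (σ m x)) (m : ℕ) (x : F) :
    mapEquiv σ h (of ι m x) = of ι m (σ m x) := rfl

end IterateLimit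

end IterateLimit

/-! ### Surjectivity of the Lang map of `GL_n` -/

/-- There is an automorphism fixing a square root of `-1` for which the Lang map
`Z ↦ Z * φ(Z)⁻¹` of `GL_n` is surjective. -/
theorem exists_ringEquiv_lang {F : Type u} [Field F] [IsAlgClosed F] [CharZero F]
    (htr : Cardinal.aleph0 ≤ Algebra.trdeg ℚ F) (n : ℕ) :
    ∃ φ : F ≃+* F, (∃ i : F, i * i = -1 ∧ φ i = i) ∧
      ∀ A : Matrix (Fin n) (Fin n) F, A.det ≠ 0 →
        ∃ Z : Matrix (Fin n) (Fin n) F, Z.det ≠ 0 ∧ A * Z.map φ = Z := by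
  obtain ⟨ι, hι⟩ := exists_ringHom_forall_extend_solving htr n
  choose next hnext hsolve using hι
  let σ : ℕ → F ≃+* F := fun m => next^[m] (RingEquiv.refl F)
  have hσ : ∀ m, σ (m + 1) = next (σ m) := fun m => Function.iterate_succ_apply' ..
  have hcompat : ∀ m x, σ (m + 1) (ι x) = ι (σ m x) := fun m x => by rw [hσ, hnext]
  let ψ := IterateLimit.mapEquiv σ hcompat
  have hcard : Cardinal.mk (IterateLimit ι) ≤ Cardinal.mk F := by
    have hinf : Cardinal.aleph0 ≤ Cardinal.mk F := by
      rw [IsAlgClosed.cardinalMk_eq_trdeg_rat htr]; exact htr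
    have hsurj : Function.Surjective fun p : ℕ × F => IterateLimit.of ι p.1 p.2 := fun x => by
      obtain ⟨m, y, h⟩ := IterateLimit.exists_of_eq ι x
      exact ⟨(m, y), h⟩
    refine (Cardinal.mk_le_of_surjective hsurj).trans ?_
    simp [hinf]
  obtain ⟨e⟩ := IsAlgClosed.nonempty_ringEquiv_of_cardinalMk_le htr (IterateLimit.of ι 0) hcard
  refine ⟨(e.trans ψ).trans e.symm, ?_, fun A hA => ?_⟩
  · obtain ⟨i, hi⟩ := IsAlgClosed.exists_eq_mul_self (-1 : F)
    refine ⟨e.symm (IterateLimit.of ι 0 i), by rw [← map_mul, ← map_mul, ← hi]; simp, ?_⟩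
    -- The automorphism of stage `0` is the identity, so the image of `i` is fixed.
    simp [ψ, IterateLimit.mapEquiv_of, σ]
  · obtain ⟨m, B, hB⟩ := IterateLimit.exists_forall_of_eq ι
      fun p : Fin n × Fin n => e (A p.1 p.2)
    let B' : Matrix (Fin n) (Fin n) F := Matrix.of fun i j => B (i, j)
    let g : ℕ → F →+* F := fun k => (e.symm : _ →+* F).comp (IterateLimit.of ι k)
    have hBA : B'.map (g m) = A := by
      ext i j
      simp [B', g, hB]
    have hB' : B'.det ≠ 0 := by
      intro h
      apply hA
      rw [← hBA, ← RingHom.mapMatrix_apply, ← RingHom.map_det, h, map_zero]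
    obtain ⟨Z, hZ, hZB⟩ := hsolve (σ m) B' hB'
    -- An equation with coefficients in stage `m` acquires its solution in stage `m + 1`.
    refine ⟨Z.map (g (m + 1)), ?_, ?_⟩
    · rw [← RingHom.mapMatrix_apply, ← RingHom.map_det]
      exact (map_ne_zero _).2 hZ
    · have h1 : A = (B'.map ι).map (g (m + 1)) := by
        rw [← hBA]
        ext i j
        simp [g, IterateLimit.of_succ]
      have h2 : (Z.map (g (m + 1))).map ((e.trans ψ).trans e.symm) =
          (Z.map (next (σ m))).map (g (m + 1)) := by
        ext i j
        simp [g, ψ, IterateLimit.mapEquiv_of, hσ]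
      rw [h2, h1, ← Matrix.map_mul, hZB]

/-! ### Congruence of symmetric matrices to diagonal ones -/

section Diagonalization

/-- Every symmetric matrix over a field of characteristic not two is congruent to a diagonal
matrix. -/
theorem Matrix.IsSymm.exists_transpose_mul_mul_eq_diagonal {k : Type*} [Field k]
    (h2 : (2 : k) ≠ 0) {n : ℕ} {G : Matrix (Fin n) (Fin n) k} (hG : G.IsSymm) :
    ∃ (B : Matrix (Fin n) (Fin n) k) (d : Fin n → k), B.det ≠ 0 ∧
      B.transpose * G * B = Matrix.diagonal d := by
  have : Invertible (2 : k) := invertibleOfNonzero h2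
  have hsymm : LinearMap.IsSymm (Matrix.toBilin' G) := by
    refine ⟨fun x y => ?_⟩
    rw [RingHom.id_apply]
    rw [Matrix.toBilin'_apply', Matrix.toBilin'_apply', Matrix.dotProduct_mulVec,
      ← Matrix.mulVec_transpose, hG.eq, dotProduct_comm]
  obtain ⟨v, hv⟩ := LinearMap.BilinForm.exists_orthogonal_basis hsymm
  let w := v.reindex (finCongr (Module.finrank_fin_fun k))
  let B : Matrix (Fin n) (Fin n) k := (Pi.basisFun k (Fin n)).toMatrix w
  have hB : B.transpose * G * B = LinearMap.BilinForm.toMatrix w (Matrix.toBilin' G) := by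
    have := LinearMap.BilinForm.toMatrix_mul_basis_toMatrix (Pi.basisFun k (Fin n)) w (Matrix.toBilin' G)
    rw [← this, LinearMap.BilinForm.toMatrix_basisFun, LinearMap.BilinForm.toMatrix'_toBilin']
  refine ⟨B, fun i => Matrix.toBilin' G (w i) (w i), ?_, ?_⟩
  · have : Invertible B := (Pi.basisFun k (Fin n)).invertibleToMatrix w
    exact (Matrix.isUnit_det_of_invertible B).ne_zero
  · rw [hB]
    ext i j
    rw [LinearMap.BilinForm.toMatrix_apply, Matrix.diagonal_apply]
    split_ifs with hij
    · rw [hij]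
    · simp only [w, Module.Basis.reindex_apply]
      exact hv (by simpa using hij)

end Diagonalization

/-! ### Rotations in coordinate planes -/

section PlaneRotation

open Matrix

variable {F : Type*} [Field F] {n : ℕ}

/-- The matrix acting as `[[x, -y], [y, x]]` on the plane of the coordinates `i` and `j`, and
trivially on the other coordinates. -/
def planeRotation (i j : Fin n) (x y : F) : Matrix (Fin n) (Fin n) F :=
  1 + (x - 1) • (single i i 1 + single j j 1) + y • (single j i 1 - single i j 1)

theorem planeRotation_apply (i j : Fin n) (x y : F) (k l : Fin n) :
    planeRotation i j x y k l = (if k = l then 1 else 0) +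
      (x - 1) * ((if i = k ∧ i = l then 1 else 0) + if j = k ∧ j = l then 1 else 0) +
      y * ((if j = k ∧ i = l then 1 else 0) - if i = k ∧ j = l then 1 else 0) := by
  simp only [planeRotation, Matrix.add_apply, Matrix.smul_apply, Matrix.sub_apply, one_apply,
    single_apply, smul_eq_mul]

theorem planeRotation_mul {i j : Fin n} (hij : i ≠ j) (x y z w : F) :
    planeRotation i j x y * planeRotation i j z w =
      planeRotation i j (x * z - y * w) (x * w + y * z) := by
  simp only [planeRotation, mul_add, add_mul, mul_sub, sub_mul, one_mul, mul_one, smul_mul_assoc,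
    mul_smul_comm, single_mul_single_same, single_mul_single_of_ne _ _ _ _ hij,
    single_mul_single_of_ne _ _ _ _ hij.symm]
  module

theorem planeRotation_one_zero (i j : Fin n) : planeRotation i j (1 : F) 0 = 1 := by
  simp [planeRotation]

theorem planeRotation_transpose (i j : Fin n) (x y : F) :
    (planeRotation i j x y).transpose = planeRotation i j x (-y) := by
  simp only [planeRotation, transpose_add, transpose_sub, transpose_smul, transpose_single,
    transpose_one]
  module

theorem planeRotation_map (φ : F →+* F) (i j : Fin n) (x y : F) :
    (planeRotation i j x y).map φ = planeRotation i j (φ x) (φ y) := by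
  ext k l
  simp [planeRotation_apply, apply_ite φ]

theorem planeRotation_mul_diagonal {i j : Fin n} (x y : F) {d : Fin n → F} (hi : d i = 1)
    (hj : d j = 1) :
    planeRotation i j x y * diagonal d = diagonal d * planeRotation i j x y := by
  ext k l
  rw [mul_diagonal, diagonal_mul, planeRotation_apply]
  grind

theorem planeRotation_neg_one_zero {i j : Fin n} (hij : i ≠ j) :
    planeRotation i j (-1 : F) 0 =
      diagonal fun k => if k ∈ ({i, j} : Finset (Fin n)) then -1 else 1 := by
  ext k l
  simp only [planeRotation_apply, diagonal_apply, Finset.mem_insert, Finset.mem_singleton]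
  grind

/-- On its plane this is the rotation with eigenvalues `c` and `c⁻¹`, since `x + I * y = c` and `x -
I * y = c⁻¹`. When `c = b * b` it is the square of the orthogonal rotation attached to `b`, so its
determinant is `1`. -/
theorem planeRotation_mem_specialOrthogonalGroup {i j : Fin n} (hij : i ≠ j) {I c : F}
    (hI : I * I = -1) (h2 : (2 : F) ≠ 0) (hc : c ≠ 0) (hsq : IsSquare c) :
    planeRotation i j ((c + c⁻¹) / 2) ((c - c⁻¹) / (2 * I)) ∈ specialOrthogonalGroup (Fin n) F := by
  have hI0 : I ≠ 0 := by rintro rfl; simp at hI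
  have key : ∀ b : F, b ≠ 0 →
      planeRotation i j ((b + b⁻¹) / 2) ((b - b⁻¹) / (2 * I)) ∈ orthogonalGroup (Fin n) F := by
    intro b hb
    rw [mem_orthogonalGroup_iff]
    change _ * (planeRotation i j ((b + b⁻¹) / 2) ((b - b⁻¹) / (2 * I))).transpose = 1
    rw [planeRotation_transpose, planeRotation_mul hij]
    convert! planeRotation_one_zero (F := F) i j using 2
    · field_simp
      linear_combination (b ^ 4 + 1 - 2 * b ^ 2) * hI
    · ring
  obtain ⟨b, rfl⟩ := hsq
  have hb : b ≠ 0 := by rintro rfl; simp at hc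
  have hdet := key b hb
  rw [mem_orthogonalGroup_iff] at hdet
  replace hdet := congrArg Matrix.det hdet
  rw [det_mul, det_transpose, det_one] at hdet
  rw [mem_specialOrthogonalGroup_iff]
  refine ⟨key _ hc, ?_⟩
  have hsquare : planeRotation i j ((b * b + (b * b)⁻¹) / 2) ((b * b - (b * b)⁻¹) / (2 * I)) =
      planeRotation i j ((b + b⁻¹) / 2) ((b - b⁻¹) / (2 * I)) *
        planeRotation i j ((b + b⁻¹) / 2) ((b - b⁻¹) / (2 * I)) := by
    rw [planeRotation_mul hij]
    congr 1
    · field_simp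
      linear_combination (b ^ 4 + 1 - 2 * b ^ 2) * hI
    · field_simp
      ring
  rw [hsquare, det_mul]
  exact hdet

end PlaneRotation

/-! ### From `GL_n` to `SO_n` -/

section TwistedConjSO

open Matrix

variable {F : Type u} [Field F] {n : ℕ}

theorem mem_specialOrthogonalGroup_iff_transpose {A : Matrix (Fin n) (Fin n) F} :
    A ∈ specialOrthogonalGroup (Fin n) F ↔ A * A.transpose = 1 ∧ A.det = 1 := by
  rw [mem_specialOrthogonalGroup_iff, mem_orthogonalGroup_iff]

/-- Twisted conjugacy in `SO_n`, in terms of matrices. -/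
theorem twistedConj_inducedSO_iff {φ : F ≃+* F} {A B : specialOrthogonalGroup (Fin n) F} :
    TwistedConj (inducedSO n φ) A B ↔
      ∃ Z : specialOrthogonalGroup (Fin n) F, A.1 * Z.1.map φ = Z.1 * B.1 := by
  refine exists_congr fun Z => ?_
  rw [eq_mul_inv_iff_mul_eq]
  exact Subtype.ext_iff

/-- A diagonal sign matrix of determinant one is twisted conjugate to the identity if `φ` fixes a
square root of `-1` and negates some nonzero element. -/
theorem exists_diagonal_neg_one_mul_map_eq [IsAlgClosed F] (h2 : (2 : F) ≠ 0) {φ : F ≃+* F}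
    {I c : F} (hI : I * I = -1) (hφI : φ I = I) (hc : c ≠ 0) (hφc : φ c = -c)
    (S : Finset (Fin n)) (hS : Even S.card) :
    ∃ Z ∈ specialOrthogonalGroup (Fin n) F,
      diagonal (fun i => if i ∈ S then (-1 : F) else 1) * Z.map φ = Z := by
  induction hN : S.card using Nat.strong_induction_on generalizing S with
  | _ N ih =>
  subst hN
  rcases S.eq_empty_or_nonempty with rfl | hne
  · exact ⟨1, one_mem _, by simp⟩
  have h1 : 1 < S.card := by
    obtain ⟨k, hk⟩ := hS
    have := hne.card_pos
    omega
  obtain ⟨i, hi, j, hj, hij⟩ := Finset.one_lt_card.1 h1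
  have hsub : ({i, j} : Finset (Fin n)) ⊆ S := by
    simp [Finset.insert_subset_iff, hi, hj]
  have hcard : (S \ {i, j}).card = S.card - 2 := by
    rw [Finset.card_sdiff_of_subset hsub, Finset.card_pair hij]
  obtain ⟨Z, hZ, hZφ⟩ := ih (S \ {i, j}).card (by omega) _
    (by rw [hcard]; exact hS.tsub even_two) rfl
  set D : Matrix (Fin n) (Fin n) F :=
    diagonal fun k => if k ∈ S \ {i, j} then (-1 : F) else 1 with hD
  set x := (c + c⁻¹) / 2 with hx
  set y := (c - c⁻¹) / (2 * I) with hy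
  -- Both coordinates are odd in `c`, and `φ` fixes `I`, so `φ` negates the rotation on its plane;
  -- the factor with two signs `-1` undoes this.
  have hφx : φ x = -x := by
    simp only [hx, map_div₀, map_add, map_inv₀, hφc, map_ofNat, inv_neg]
    ring
  have hφy : φ y = -y := by
    simp only [hy, map_div₀, map_sub, map_mul, map_inv₀, hφc, hφI, map_ofNat, inv_neg]
    ring
  have hW : planeRotation i j x y ∈ specialOrthogonalGroup (Fin n) F :=
    planeRotation_mem_specialOrthogonalGroup hij hI h2 hc (IsAlgClosed.exists_eq_mul_self c)
  have hDS : diagonal (fun k => if k ∈ S then (-1 : F) else 1) =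
      D * planeRotation i j (-1 : F) 0 := by
    rw [planeRotation_neg_one_zero hij, hD, diagonal_mul_diagonal]
    congr 1
    ext k
    have := @hsub k
    grind
  refine ⟨planeRotation i j x y * Z, mul_mem hW hZ, ?_⟩
  have hmap : (planeRotation i j x y).map φ = planeRotation i j (-x) (-y) := by
    rw [← hφx, ← hφy]
    exact planeRotation_map (φ : F →+* F) i j x y
  have hcomm : planeRotation i j x y * D = D * planeRotation i j x y :=
    planeRotation_mul_diagonal x y (by simp) (by simp)
  rw [Matrix.map_mul, hmap, hDS, mul_assoc D, ← mul_assoc (planeRotation i j _ _) _ (Z.map φ),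
    planeRotation_mul hij]
  simp only [zero_mul, mul_neg, neg_mul, one_mul, neg_neg, neg_zero, sub_zero, add_zero]
  rw [← mul_assoc, ← hcomm, mul_assoc, hZφ]

/-- If the Lang map of `GL_n` is surjective then every orthogonal matrix is twisted conjugate,
by an orthogonal matrix, to a diagonal matrix of signs. -/
theorem exists_orthogonal_mul_map_eq_mul_diagonal [IsAlgClosed F] (h2 : (2 : F) ≠ 0)
    {φ : F ≃+* F} {A : Matrix (Fin n) (Fin n) F} (hA : A.transpose * A = 1)
    {Z : Matrix (Fin n) (Fin n) F} (hZ : Z.det ≠ 0) (hAZ : A * Z.map φ = Z) :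
    ∃ (Y : Matrix (Fin n) (Fin n) F) (ε : Fin n → F), Y.transpose * Y = 1 ∧
      (∀ i, ε i = 1 ∨ ε i = -1) ∧ A * Y.map φ = Y * diagonal ε := by
  let k : Subfield F := RingHom.eqLocusField (φ : F →+* F) (RingHom.id F)
  have hk : ∀ x : k, φ x = x := fun x => x.2
  have hGφ : (Z.transpose * Z).map φ = Z.transpose * Z := by
    conv_rhs => rw [← hAZ]
    rw [transpose_mul, mul_assoc, ← mul_assoc A.transpose, hA, one_mul, Matrix.map_mul,
      transpose_map]
  let G : Matrix (Fin n) (Fin n) k :=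
    Matrix.of fun i j => ⟨(Z.transpose * Z) i j, congrFun (congrFun hGφ i) j⟩
  have hG : G.map k.subtype = Z.transpose * Z := by ext i j; rfl
  have hGsymm : G.IsSymm := by
    ext i j
    change (Z.transpose * Z) j i = (Z.transpose * Z) i j
    rw [← transpose_apply (Z.transpose * Z), transpose_mul, transpose_transpose]
  have h2k : (2 : k) ≠ 0 := fun h => h2 (congrArg k.subtype h)
  obtain ⟨B, d, hB, hBd⟩ := hGsymm.exists_transpose_mul_mul_eq_diagonal h2k
  let B' : Matrix (Fin n) (Fin n) F := B.map k.subtype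
  have hB'φ : B'.map φ = B' := by ext i j; exact hk _
  have hB'det : B'.det ≠ 0 := by
    have := RingHom.map_det k.subtype B
    rw [RingHom.mapMatrix_apply] at this
    exact this ▸ (map_ne_zero _).2 hB
  have hdiag : B'.transpose * (Z.transpose * Z) * B' = diagonal fun i => (d i : F) := by
    rw [← hG, show B'.transpose = B.transpose.map k.subtype from rfl, ← Matrix.map_mul, ← Matrix.map_mul, hBd, diagonal_map (map_zero _)]
    rfl
  choose c hc using fun i => IsAlgClosed.exists_eq_mul_self (d i : F)
  have hc0 : ∀ i, c i ≠ 0 := by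
    have hdet := congrArg Matrix.det hdiag
    rw [det_mul, det_mul, det_mul, det_transpose, det_transpose, det_diagonal] at hdet
    have hprod : ∏ i, (d i : F) ≠ 0 := by
      rw [← hdet]
      positivity
    intro i hi
    exact Finset.prod_ne_zero_iff.1 hprod i (Finset.mem_univ i) (by rw [hc, hi, mul_zero])
  -- `c i` is a square root of an element fixed by `φ`.
  have hφc : ∀ i, ∃ e : F, (e = 1 ∨ e = -1) ∧ φ (c i) = e * c i := by
    intro i
    have h : φ (c i) * φ (c i) = c i * c i := by rw [← map_mul, ← hc, hk]
    rcases mul_self_eq_mul_self_iff.1 h with h | h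
    · exact ⟨1, Or.inl rfl, by rw [h, one_mul]⟩
    · exact ⟨-1, Or.inr rfl, by rw [h, neg_one_mul]⟩
  choose ε hε hεc using hφc
  refine ⟨Z * B' * diagonal fun i => (c i)⁻¹, ε, ?_, hε, ?_⟩
  · have h : (Z * B' * diagonal fun i => (c i)⁻¹).transpose * (Z * B' * diagonal fun i => (c i)⁻¹) =
        (diagonal fun i => (c i)⁻¹) * (B'.transpose * (Z.transpose * Z) * B') *
          diagonal fun i => (c i)⁻¹ := by
      simp only [transpose_mul, diagonal_transpose, mul_assoc]
    rw [h, hdiag, diagonal_mul_diagonal, diagonal_mul_diagonal, ← diagonal_one]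
    congr 1
    ext i
    rw [hc]
    field_simp [hc0 i]
  · have hinv : (diagonal fun i => (c i)⁻¹).map φ = (diagonal fun i => (c i)⁻¹) * diagonal ε := by
      rw [diagonal_map (map_zero _), diagonal_mul_diagonal]
      congr 1
      ext i
      rw [map_inv₀, hεc, mul_inv, mul_comm]
      rcases hε i with h | h <;> rw [h] <;> simp
    rw [Matrix.map_mul, Matrix.map_mul, hB'φ, hinv, ← mul_assoc, ← mul_assoc, ← mul_assoc, hAZ]

/-- If `φ` fixes a square root of `-1` and the Lang map of `GL_n` is surjective, then every
element of `SO_n` is twisted conjugate to the identity. -/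
theorem twistedConj_inducedSO_one [IsAlgClosed F] (h2 : (2 : F) ≠ 0) (hn : 1 ≤ n) {φ : F ≃+* F}
    {I : F} (hI : I * I = -1) (hφI : φ I = I)
    (hφ : ∀ A : Matrix (Fin n) (Fin n) F, A.det ≠ 0 →
        ∃ Z : Matrix (Fin n) (Fin n) F, Z.det ≠ 0 ∧ A * Z.map φ = Z)
    (A : specialOrthogonalGroup (Fin n) F) : TwistedConj (inducedSO n φ) A 1 := by
  obtain ⟨hA1, hA2⟩ := mem_specialOrthogonalGroup_iff_transpose.1 A.2
  -- Solve the Lang equation for `-1`: any nonzero entry of the solution is negated by `φ`.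
  obtain ⟨c, hc, hφc⟩ : ∃ c : F, c ≠ 0 ∧ φ c = -c := by
    obtain ⟨Z, hZ, hZφ⟩ := hφ (-1) (by simp [det_neg])
    have : Z ≠ 0 := by
      rintro rfl
      have : Nonempty (Fin n) := ⟨⟨0, hn⟩⟩
      exact hZ det_zero
    obtain ⟨i, j, hij⟩ : ∃ i j, Z i j ≠ 0 := by
      by_contra! h
      exact this (by ext i j; exact h i j)
    refine ⟨Z i j, hij, ?_⟩
    have := congrFun (congrFun hZφ i) j
    rw [neg_one_mul, Matrix.neg_apply, map_apply] at this
    rw [← this, neg_neg, this]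
  obtain ⟨Z, hZ, hAZ⟩ := hφ A.1 (by rw [hA2]; exact one_ne_zero)
  obtain ⟨Y, ε, hY, hε, hAY⟩ := exists_orthogonal_mul_map_eq_mul_diagonal h2
    (mul_eq_one_comm.1 hA1) hZ hAZ
  have hYdet : Y.det = 1 ∨ Y.det = -1 := by
    have := congrArg Matrix.det hY
    rw [det_mul, det_transpose, det_one] at this
    exact mul_self_eq_one_iff.1 this
  classical
  let S : Finset (Fin n) := Finset.univ.filter fun i => ε i = -1
  have hεS : ε = fun i => if i ∈ S then (-1 : F) else 1 := by
    ext i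
    rcases hε i with h | h
    · have : (1 : F) ≠ -1 := fun h' => h2 (by linear_combination h')
      simp [S, h, this]
    · simp [S, h]
  have hprod : ∏ i, ε i = 1 := by
    have h := congrArg Matrix.det hAY
    rw [det_mul, det_mul, hA2, one_mul, det_diagonal] at h
    have hφdet : (Y.map φ).det = Y.det := by
      have := RingHom.map_det (φ : F →+* F) Y
      rw [RingHom.mapMatrix_apply] at this
      rw [show (Y.map φ).det = φ Y.det from this.symm]
      rcases hYdet with h | h <;> rw [h] <;> simp
    rw [hφdet] at h
    have hne : Y.det ≠ 0 := by rcases hYdet with h | h <;> rw [h] <;> simp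
    exact mul_left_cancel₀ hne (by rw [← h, mul_one])
  have hS : Even S.card := by
    rw [hεS, Finset.prod_ite_mem, Finset.univ_inter, Finset.prod_const] at hprod
    by_contra hodd
    rw [Nat.not_even_iff_odd] at hodd
    rw [hodd.neg_one_pow] at hprod
    exact h2 (by linear_combination -hprod)
  obtain ⟨X, hY', hAX⟩ : ∃ X ∈ specialOrthogonalGroup (Fin n) F,
      A.1 * X.map φ = X * diagonal ε := by
    rcases hYdet with h | h
    · exact ⟨Y, mem_specialOrthogonalGroup_iff_transpose.2 ⟨mul_eq_one_comm.1 hY, h⟩, hAY⟩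
    -- Negating the first column of `Y` corrects its determinant; this sign matrix is fixed by `φ`
    -- and commutes with `diagonal ε`.
    · let r : Fin n → F := Function.update 1 ⟨0, hn⟩ (-1)
      have hr : ∀ i, r i = 1 ∨ r i = -1 := by
        intro i
        by_cases hi : i = ⟨0, hn⟩
        · right; simp [r, hi]
        · left; simp [r, hi]
      have hrr : diagonal r * diagonal r = 1 := by
        rw [diagonal_mul_diagonal, ← diagonal_one]
        congr 1
        ext i
        rcases hr i with h | h <;> rw [h] <;> simp
      have hrdet : (diagonal r).det = -1 := by
        rw [det_diagonal, Finset.prod_update_of_mem (Finset.mem_univ _)]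
        simp
      have hrφ : (diagonal r).map φ = diagonal r := by
        rw [diagonal_map (map_zero _)]
        congr 1
        ext i
        rcases hr i with h | h <;> rw [h] <;> simp
      refine ⟨Y * diagonal r, mem_specialOrthogonalGroup_iff_transpose.2 ⟨?_, ?_⟩, ?_⟩
      · rw [transpose_mul, diagonal_transpose, mul_assoc, ← mul_assoc (diagonal r), hrr, one_mul]
        exact mul_eq_one_comm.1 hY
      · rw [det_mul, h, hrdet]; simp
      · rw [Matrix.map_mul, hrφ, ← mul_assoc, hAY, mul_assoc, mul_assoc, diagonal_mul_diagonal,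
          diagonal_mul_diagonal]
        simp_rw [mul_comm]
  obtain ⟨W, hW, hWφ⟩ := exists_diagonal_neg_one_mul_map_eq h2 hI hφI hc hφc S hS
  refine twistedConj_inducedSO_iff.2 ⟨⟨X * W, mul_mem hY' hW⟩, ?_⟩
  change A.1 * (X * W).map φ = X * W * 1
  rw [Matrix.map_mul, ← mul_assoc, hAX, mul_assoc, hεS, hWφ, mul_one]

end TwistedConjSO

theorem corollary1 {F : Type*} [Field F] [IsAlgClosed F] [CharZero F]
    (htr : Cardinal.aleph0 ≤ Algebra.trdeg ℚ F) (n : ℕ) (hn : 1 ≤ n) :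
    ∃ φ : F ≃+* F,
      reidemeisterNumber (inducedSO n φ) = 1 ∧
      ∀ A : Matrix.specialOrthogonalGroup (Fin n) F, TwistedConj (inducedSO n φ) A 1 := by
  obtain ⟨φ, ⟨I, hI, hφI⟩, hφ⟩ := exists_ringEquiv_lang htr n
  have h := twistedConj_inducedSO_one two_ne_zero hn hI hφI hφ
  refine ⟨φ, ?_, h⟩
  have h1 : ∀ x : Quotient (twistedConjSetoid (inducedSO n φ)), x = Quotient.mk _ 1 :=
    fun x => x.inductionOn fun A => Quotient.sound (h A)
  rw [reidemeisterNumber, ENat.card_eq_one_iff_unique]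
  exact ⟨⟨⟨Quotient.mk _ 1⟩, h1⟩⟩
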